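/- Let $\mathcal X$ be a real or complex Banach space with $\dim\mathcal X\ge 2$. Let $\mathcal N$ be a nest on $\mathcal X$, i.e. a chain of closed subspaces of $\mathcal X$ containing $\{0\}$ and $\mathcal X$ such that the intersection and the closed linear span of every family of members of $\mathcal N$ belong to $\mathcal N$. For $N\in\mathcal N$ let $N_-$ be the closed linear span of $\bigcup\{M\in\mathcal N : M\subsetneq N\}$, and assume that every $N\in\mathcal N$ with $N_-=N$ is complemented in $\mathcal X$. Let $\mathrm{Alg}\,\mathcal N$ be the algebra of all bounded linear operators on $\mathcal X$ that leave every member of $\mathcal N$ invariant. A linear map $\gamma$ on an algebra $\mathcal A$ is a generalized derivation if there is a linear map $\tau:\mathcal A\to\mathcal A$ with $\gamma(ab)=\gamma(a)b+a\tau(b)$ for all $a,b\in\mathcal A$. A linear map $\delta$ on $\mathcal A$ is a local generalized derivation if for every $a\in\mathcal A$ there is a generalized derivation $\delta_a:\mathcal A\to\mathcal A$ with $\delta(a)=\delta_a(a)$. Then for every linear map $\delta:\mathrm{Alg}\,\mathcal N\to\mathrm{Alg}\,\mathcal N$ (not assumed continuous) the following are equivalent: (i) $\delta$ is a generalized derivation;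 (ii) $\delta$ is a local generalized derivation; (iii) $A\delta(B)C=0$ for all $A,B,C\in\mathrm{Alg}\,\mathcal N$ with $AB=BC=0$. -/

import Mathlib

section NestAlgebras

variable {𝕜 X : Type*} [RCLike 𝕜] [NormedAddCommGroup X] [NormedSpace 𝕜 X]

/-- A nest on `X`: a chain of closed subspaces containing `{0}` and `X` and closed under arbitrary
intersections and closed linear spans. In the complete lattice `ClosedSubmodule 𝕜 X`, `sInf` is the
intersection and `sSup` is the closure of the linear span of the union. -/
structure IsNest (𝒩 : Set (ClosedSubmodule 𝕜 X)) : Prop where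
  chain : IsChain (· ≤ ·) 𝒩
  bot_mem : ⊥ ∈ 𝒩
  top_mem : ⊤ ∈ 𝒩
  sInf_mem : ∀ S : Set (ClosedSubmodule 𝕜 X), S ⊆ 𝒩 → sInf S ∈ 𝒩
  sSup_mem : ∀ S : Set (ClosedSubmodule 𝕜 X), S ⊆ 𝒩 → sSup S ∈ 𝒩

/-- `N₋`: the closed linear span of all members of `𝒩` properly contained in `N`. -/
noncomputable def nestPred (𝒩 : Set (ClosedSubmodule 𝕜 X)) (N : ClosedSubmodule 𝕜 X) :
    ClosedSubmodule 𝕜 X :=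
  sSup {M | M ∈ 𝒩 ∧ M < N}

/-- `Alg 𝒩`: the algebra of bounded operators on `X` leaving every member of `𝒩` invariant. -/
def nestAlgebra (𝒩 : Set (ClosedSubmodule 𝕜 X)) : Subalgebra 𝕜 (X →L[𝕜] X) where
  carrier := {A | ∀ N ∈ 𝒩, ∀ x ∈ N, A x ∈ N}
  mul_mem' := fun {A B} hA hB N hN x hx => hA N hN (B x) (hB N hN x hx)
  add_mem' := fun {_ _} hA hB N hN x hx =>
    N.toSubmodule.add_mem (hA N hN x hx) (hB N hN x hx)
  algebraMap_mem' := fun r N _ x hx => by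
    have h : (algebraMap 𝕜 (X →L[𝕜] X) r) x = r • x := by
      simp [Algebra.algebraMap_eq_smul_one]
    rw [h]
    exact N.toSubmodule.smul_mem r hx

end NestAlgebras

section Derivations

variable {R A : Type*} [CommRing R] [Ring A] [Algebra R A]

/-- `(γ, δ, τ)` is a ternary derivation: `γ(ab) = δ(a)b + aτ(b)` for all `a`, `b`. -/
def IsTernaryDerivation (γ δ τ : A →ₗ[R] A) : Prop :=
  ∀ a b : A, γ (a * b) = δ a * b + a * τ b

/-- `γ` is a generalized derivation: `(γ, γ, τ)` is a ternary derivation for some linear `τ`. -/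
def IsGeneralizedDerivation (γ : A →ₗ[R] A) : Prop :=
  ∃ τ : A →ₗ[R] A, IsTernaryDerivation γ γ τ

/-- `δ` agrees at each point with some generalized derivation depending on the point. -/
def IsLocalGeneralizedDerivation (δ : A →ₗ[R] A) : Prop :=
  ∀ a : A, ∃ δ' : A →ₗ[R] A, IsGeneralizedDerivation δ' ∧ δ a = δ' a

end Derivations

/-! For (iii) ⇒ (i), zero products such as `(1 - p) * (p * b * q) = 0` show that `δ` satisfies the
generalized Leibniz identity when the outer factors are idempotents, and the identity passes to the
algebra they generate. If that algebra contains a set absorbing multiplication on both sides and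
having zero annihilators, the outer factors can be absorbed and cancelled
(`isGeneralizedDerivation_of_faithful_ideal`). In a nest algebra the rank-one operators form such a
set. -/

section ZeroProducts

variable {R A : Type*} [CommRing R] [Ring A] [Algebra R A]

/-- The subalgebra generated by the idempotents of `A`. -/
abbrev idempotentSubalgebra (R A : Type*) [CommRing R] [Ring A] [Algebra R A] : Subalgebra R A :=
  Algebra.adjoin R {p : A | IsIdempotentElem p}

theorem mem_idempotentSubalgebra_of_isIdempotentElem {p : A} (hp : IsIdempotentElem p) :
    p ∈ idempotentSubalgebra R A :=
  Algebra.subset_adjoin hp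

/-- A local generalized derivation preserves two-sided zero products. -/
theorem IsLocalGeneralizedDerivation.mul_apply_mul_eq_zero {δ : A →ₗ[R] A}
    (hδ : IsLocalGeneralizedDerivation δ) {a b c : A} (hab : a * b = 0) (hbc : b * c = 0) :
    a * δ b * c = 0 := by
  obtain ⟨γ, ⟨τ, hτ⟩, h⟩ := hδ b
  have h₁ : γ b = γ 1 * b + τ b := by simpa using hτ 1 b
  have h₂ : a * τ b = -(γ a * b) := by
    have := hτ a b
    rw [hab, map_zero] at this
    exact eq_neg_of_add_eq_zero_right this.symm
  calc a * δ b * c = a * γ 1 * (b * c) + a * τ b * c := by rw [h, h₁]; noncomm_ring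
    _ = a * γ 1 * (b * c) - γ a * (b * c) := by rw [h₂]; noncomm_ring
    _ = 0 := by rw [hbc]; simp

variable {δ : A →ₗ[R] A}

theorem apply_mul_mul_of_mem_idempotentSubalgebra
    (hδ : ∀ a b c : A, a * b = 0 → b * c = 0 → a * δ b * c = 0)
    {q s : A} (hq : IsIdempotentElem q)
    (hs : s ∈ idempotentSubalgebra R A) (b : A) :
    δ (s * b * q) * (1 - q) = s * δ (b * q) * (1 - q) := by
  induction hs using Algebra.adjoin_induction generalizing b with
  | mem p hp =>
    have hp : p * p = p := hp
    have hq : q * q = q := hq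
    -- Both sides of the claim equal `p * δ (p * b * q) * (1 - q)`.
    have h₁ : (1 - p) * δ (p * b * q) * (1 - q) = 0 := by
      apply hδ
      · rw [sub_mul, one_mul, ← mul_assoc, ← mul_assoc, hp, sub_self]
      · rw [mul_sub, mul_one, mul_assoc _ q, hq, sub_self]
    have h₂ : p * δ ((1 - p) * b * q) * (1 - q) = 0 := by
      apply hδ
      · rw [← mul_assoc, ← mul_assoc, mul_sub, mul_one, hp, sub_self, zero_mul, zero_mul]
      · rw [mul_sub, mul_one, mul_assoc _ q, hq, sub_self]
    rw [sub_mul 1 p b, sub_mul, one_mul, map_sub, mul_sub p, sub_mul, sub_eq_zero] at h₂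
    rw [sub_mul 1 p, one_mul, sub_mul, sub_eq_zero] at h₁
    rw [h₁, h₂]
  | algebraMap r =>
    simp [Algebra.algebraMap_eq_smul_one]
  | add x y _ _ hx hy => simp only [add_mul, map_add, hx, hy]
  | mul x y _ _ hx hy =>
    rw [mul_assoc x y b, hx, mul_assoc x, hy, ← mul_assoc, ← mul_assoc]

/-- For an idempotent `q`, compare the previous identity at `q` and at `1 - q`; the result is
multiplicative in `t`. -/
theorem apply_mul_mul_sub_of_mem_idempotentSubalgebra
    (hδ : ∀ a b c : A, a * b = 0 → b * c = 0 → a * δ b * c = 0)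
    {s t : A}
    (hs : s ∈ idempotentSubalgebra R A) (ht : t ∈ idempotentSubalgebra R A) (b : A) :
    δ (s * b * t) - s * δ (b * t) = (δ (s * b) - s * δ b) * t := by
  induction ht using Algebra.adjoin_induction generalizing b with
  | mem q hq =>
    have h₁ := apply_mul_mul_of_mem_idempotentSubalgebra hδ hq hs b
    have h₂ := apply_mul_mul_of_mem_idempotentSubalgebra hδ (IsIdempotentElem.one_sub hq) hs b
    simp only [mul_sub, sub_mul, mul_one, map_sub, sub_sub_cancel] at h₁ h₂
    rw [sub_mul]
    grind
  | algebraMap r =>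
    simp [Algebra.algebraMap_eq_smul_one, smul_sub]
  | add x y _ _ hx hy =>
    rw [mul_add, mul_add, map_add, map_add, mul_add, mul_add, ← hx, ← hy]
    abel
  | mul x y _ _ hx hy =>
    rw [← mul_assoc, ← mul_assoc, mul_assoc s b x, hy, ← mul_assoc, hx, mul_assoc]

/-- If the idempotents of `A` generate a subalgebra containing a two-sided multiplicative ideal
with trivial annihilators, then a linear map preserving two-sided zero products is a generalized
derivation. -/
theorem isGeneralizedDerivation_of_faithful_ideal
    (hδ : ∀ a b c : A, a * b = 0 → b * c = 0 → a * δ b * c = 0)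
    (I : Set A)
    (hI : I ⊆ idempotentSubalgebra R A)
    (hI_right : ∀ s ∈ I, ∀ a, s * a ∈ I) (hI_left : ∀ s ∈ I, ∀ a, a * s ∈ I)
    (hI_faithful_left : ∀ a, (∀ s ∈ I, s * a = 0) → a = 0)
    (hI_faithful_right : ∀ a, (∀ s ∈ I, a * s = 0) → a = 0) :
    IsGeneralizedDerivation δ := by
  have key : ∀ t ∈ I, ∀ a b, δ (a * b * t) - a * δ (b * t) = (δ (a * b) - a * δ b) * t := by
    intro t ht a b
    rw [← sub_eq_zero]
    refine hI_faithful_left _ fun s hs => ?_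
    have h₁ := apply_mul_mul_sub_of_mem_idempotentSubalgebra hδ (hI (hI_right s hs a)) (hI ht) b
    have h₂ := apply_mul_mul_sub_of_mem_idempotentSubalgebra hδ (hI hs) (hI ht) (a * b)
    simp only [sub_mul, mul_sub, mul_assoc] at h₁ h₂ ⊢
    grind
  have main : ∀ a c, δ (a * c) - a * δ c = (δ a - a * δ 1) * c := by
    intro a c
    rw [← sub_eq_zero]
    refine hI_faithful_right _ fun t ht => ?_
    have h₁ := key (c * t) (hI_left t ht c) a 1
    have h₂ := key t ht a c
    simp only [sub_mul, mul_assoc, one_mul, mul_one] at h₁ h₂ ⊢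
    grind
  -- Taking `a = 1` in the defining identity forces this `τ`.
  refine ⟨δ - LinearMap.mulLeft R (δ 1), fun a b => ?_⟩
  have h := main a b
  simp only [LinearMap.sub_apply, LinearMap.mulLeft_apply]
  rw [sub_mul, sub_eq_iff_eq_add] at h
  rw [h]
  noncomm_ring

end ZeroProducts

/-! ### Rank-one operators in nest algebras -/

section NestAlgebras

variable {𝕜 X : Type*} [RCLike 𝕜] [NormedAddCommGroup X] [NormedSpace 𝕜 X]

/-- A point outside a closed subspace is separated from it by a functional. -/
theorem ClosedSubmodule.exists_strongDual_eq_one (N : ClosedSubmodule 𝕜 X) {y : X} (hy : y ∉ N) :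
    ∃ f : StrongDual 𝕜 X, (∀ x ∈ N, f x = 0) ∧ f y = 1 := by
  have : IsClosed (N.toSubmodule : Set X) := N.isClosed
  have hy' : N.toSubmodule.mkQ y ≠ 0 := by simpa using hy
  obtain ⟨g, hg⟩ := SeparatingDual.exists_eq_one (R := 𝕜) hy'
  refine ⟨g.comp N.toSubmodule.mkQL, fun x hx => ?_, by simpa using hg⟩
  have : N.toSubmodule.mkQ x = 0 := by simpa using hx
  simpa using congrArg g this

variable {𝒩 : Set (ClosedSubmodule 𝕜 X)} {N : ClosedSubmodule 𝕜 X}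

theorem le_nestPred {M : ClosedSubmodule 𝕜 X} (hM : M ∈ 𝒩) (h : M < N) : M ≤ nestPred 𝒩 N :=
  le_sSup ⟨hM, h⟩

theorem nestPred_le (𝒩 : Set (ClosedSubmodule 𝕜 X)) (N : ClosedSubmodule 𝕜 X) :
    nestPred 𝒩 N ≤ N :=
  sSup_le fun _ hM => hM.2.le

theorem IsNest.nestPred_mem (h𝒩 : IsNest 𝒩) (N : ClosedSubmodule 𝕜 X) : nestPred 𝒩 N ∈ 𝒩 :=
  h𝒩.sSup_mem _ fun _ hM => hM.1

theorem IsNest.lt_or_le (h𝒩 : IsNest 𝒩) {M : ClosedSubmodule 𝕜 X} (hM : M ∈ 𝒩) (hN : N ∈ 𝒩) :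
    M < N ∨ N ≤ M := by
  rcases h𝒩.chain.total hM hN with h | h
  · exact h.lt_or_eq.imp_right fun h => h.ge
  · exact .inr h

theorem IsNest.smulRight_mem (h𝒩 : IsNest 𝒩) (hN : N ∈ 𝒩) {x : X} (hx : x ∈ N)
    {f : StrongDual 𝕜 X} (hf : ∀ z ∈ nestPred 𝒩 N, f z = 0) : f.smulRight x ∈ nestAlgebra 𝒩 := by
  intro M hM z hz
  rw [ContinuousLinearMap.smulRight_apply]
  rcases h𝒩.lt_or_le hM hN with h | h
  · rw [hf z (le_nestPred hM h hz), zero_smul]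
    exact zero_mem M
  · exact M.toSubmodule.smul_mem _ (h hx)

/-- The rank-one operators `f ⊗ x` of the nest algebra, with `x ∈ N` and `f` vanishing on `N₋`. -/
def nestRankOne (𝒩 : Set (ClosedSubmodule 𝕜 X)) : Set (nestAlgebra 𝒩) :=
  {T | ∃ N ∈ 𝒩, ∃ x ∈ N, ∃ f : StrongDual 𝕜 X, (∀ z ∈ nestPred 𝒩 N, f z = 0) ∧
    (T : X →L[𝕜] X) = f.smulRight x}

theorem IsNest.mul_mem_nestRankOne_right (h𝒩 : IsNest 𝒩) {T : nestAlgebra 𝒩}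
    (hT : T ∈ nestRankOne 𝒩) (A : nestAlgebra 𝒩) : T * A ∈ nestRankOne 𝒩 := by
  obtain ⟨N, hN, x, hx, f, hf, h⟩ := hT
  refine ⟨N, hN, x, hx, f.comp (A : X →L[𝕜] X),
    fun z hz => hf _ (A.2 _ (h𝒩.nestPred_mem N) z hz), ?_⟩
  ext z
  simp [h]

theorem mul_mem_nestRankOne_left {T : nestAlgebra 𝒩} (hT : T ∈ nestRankOne 𝒩)
    (A : nestAlgebra 𝒩) : A * T ∈ nestRankOne 𝒩 := by
  obtain ⟨N, hN, x, hx, f, hf, h⟩ := hT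
  refine ⟨N, hN, (A : X →L[𝕜] X) x, A.2 N hN x hx, f, hf, ?_⟩
  ext z
  simp [h]

theorem IsNest.eq_zero_of_forall_nestRankOne_mul (h𝒩 : IsNest 𝒩) (A : nestAlgebra 𝒩)
    (hA : ∀ T ∈ nestRankOne 𝒩, T * A = 0) : A = 0 := by
  have hpred : ∀ N ∈ 𝒩, N ≠ ⊥ → ∀ z, (A : X →L[𝕜] X) z ∈ nestPred 𝒩 N := by
    intro N hN hbot z
    by_contra hz
    obtain ⟨f, hf, hfz⟩ := (nestPred 𝒩 N).exists_strongDual_eq_one hz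
    obtain ⟨x, hx, hx0⟩ : ∃ x ∈ N, x ≠ 0 := by
      by_contra! h
      exact hbot (le_bot_iff.mp fun x hx => h x hx)
    have h := hA ⟨_, h𝒩.smulRight_mem hN hx hf⟩ ⟨N, hN, x, hx, f, hf, rfl⟩
    have h := congrArg (fun S : nestAlgebra 𝒩 => (S : X →L[𝕜] X) z) h
    exact hx0 (by simpa [hfz] using h)
  -- The range of `A` lies in `N₋` for every nonzero `N`, hence in `M`. Either `M = 0`, or `M` is
  -- the least nonzero member and `M₋ = 0`.
  set M : ClosedSubmodule 𝕜 X := sInf {N | N ∈ 𝒩 ∧ N ≠ ⊥}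
  have hM𝒩 : M ∈ 𝒩 := h𝒩.sInf_mem _ fun _ h => h.1
  have hAM : ∀ z, (A : X →L[𝕜] X) z ∈ M := fun z =>
    ClosedSubmodule.mem_sInf.mpr fun N hN => nestPred_le 𝒩 N (hpred N hN.1 hN.2 z)
  apply Subtype.ext
  ext z
  by_cases hbot : M = ⊥
  · have := hAM z
    rw [hbot] at this
    exact this
  · have hMpred : nestPred 𝒩 M = ⊥ := by
      refine le_bot_iff.mp (sSup_le fun N hN => ?_)
      by_contra h
      exact hN.2.not_ge (sInf_le ⟨hN.1, fun h' => h h'.le⟩)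
    have := hpred M hM𝒩 hbot z
    rw [hMpred] at this
    exact this

theorem IsNest.eq_zero_of_forall_mul_nestRankOne (h𝒩 : IsNest 𝒩) (A : nestAlgebra 𝒩)
    (hA : ∀ T ∈ nestRankOne 𝒩, A * T = 0) : A = 0 := by
  have hker : ∀ N ∈ 𝒩, nestPred 𝒩 N ≠ ⊤ →
      N ≤ (⊥ : ClosedSubmodule 𝕜 X).comap (A : X →L[𝕜] X) := by
    intro N hN htop x hx
    obtain ⟨z, hz⟩ : ∃ z, z ∉ nestPred 𝒩 N := by
      by_contra! h
      exact htop (top_le_iff.mp fun z _ => h z)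
    obtain ⟨f, hf, hfz⟩ := (nestPred 𝒩 N).exists_strongDual_eq_one hz
    have h := hA ⟨_, h𝒩.smulRight_mem hN hx hf⟩ ⟨N, hN, x, hx, f, hf, rfl⟩
    have h := congrArg (fun S : nestAlgebra 𝒩 => (S : X →L[𝕜] X) z) h
    simpa [hfz] using h
  have htop : (⊤ : ClosedSubmodule 𝕜 X) ≤ (⊥ : ClosedSubmodule 𝕜 X).comap (A : X →L[𝕜] X) := by
    -- `A` kills each `N` with `N₋ ≠ X`: either `X` itself is one, or the proper members span a
    -- dense subspace.
    by_cases h : nestPred 𝒩 (⊤ : ClosedSubmodule 𝕜 X) = ⊤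
    · rw [← h]
      exact sSup_le fun N hN => hker N hN.1 ((nestPred_le 𝒩 N).trans_lt hN.2).ne
    · exact hker ⊤ h𝒩.top_mem h
  apply Subtype.ext
  ext z
  exact htop (show z ∈ (⊤ : ClosedSubmodule 𝕜 X) from trivial)

theorem mem_idempotentSubalgebra_of_eq_smulRight {T : nestAlgebra 𝒩} {f : StrongDual 𝕜 X} {x : X}
    (hT : (T : X →L[𝕜] X) = f.smulRight x) (hfx : f x ≠ 0) :
    T ∈ idempotentSubalgebra 𝕜 (nestAlgebra 𝒩) := by
  have hp : IsIdempotentElem ((f x)⁻¹ • T) := by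
    apply Subtype.ext
    ext z
    have h : (f x)⁻¹ * (f x)⁻¹ * (f z * f x) = (f x)⁻¹ * f z := by field_simp
    simp [hT, smul_smul, h]
  have := Subalgebra.smul_mem _ (mem_idempotentSubalgebra_of_isIdempotentElem (R := 𝕜) hp) (f x)
  rwa [smul_inv_smul₀ hfx] at this

theorem IsNest.nestRankOne_subset_idempotentSubalgebra (h𝒩 : IsNest 𝒩)
    (hcompl : ∀ N ∈ 𝒩, nestPred 𝒩 N = N → N.toSubmodule.ClosedComplemented) :
    nestRankOne 𝒩 ⊆ idempotentSubalgebra 𝕜 (nestAlgebra 𝒩) := by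
  rintro T ⟨N, hN, x, hx, f, hf, hT⟩
  by_cases hpred : nestPred 𝒩 N = N
  · obtain ⟨π, hπ⟩ := hcompl N hN hpred
    rw [hpred] at hf
    have hπN : ∀ z ∈ N, (π z : X) = z := fun z hz => congrArg Subtype.val (hπ ⟨z, hz⟩)
    have hP : N.toSubmodule.subtypeL.comp π ∈ nestAlgebra 𝒩 := by
      intro M hM z hz
      rcases h𝒩.lt_or_le hM hN with h | h
      · simpa [hπN z (h.le hz)] using hz
      · exact h (π z).2
    set P : nestAlgebra 𝒩 := ⟨_, hP⟩ with hPdef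
    have hPidem : IsIdempotentElem P := by
      apply Subtype.ext
      ext z
      exact hπN _ (π z).2
    -- `PT = T`, while `TP = 0` and `T² = 0` because `f` vanishes on `N₋ = N`.
    have hPT : IsIdempotentElem (P + T) := by
      apply Subtype.ext
      ext z
      have hπx := hπN x hx
      have hππ := hπN _ (π z).2
      have hfπ : f (π z) = 0 := hf _ (π z).2
      simp [hPdef, hT, hπx, hππ, hfπ, hf x hx]
    have := sub_mem (mem_idempotentSubalgebra_of_isIdempotentElem (R := 𝕜) hPT)
      (mem_idempotentSubalgebra_of_isIdempotentElem hPidem)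
    rwa [add_sub_cancel_left] at this
  · obtain ⟨y, hyN, hy⟩ : ∃ y ∈ N, y ∉ nestPred 𝒩 N := by
      by_contra! h
      exact hpred ((nestPred_le 𝒩 N).antisymm h)
    obtain ⟨g, hg, hgy⟩ := (nestPred 𝒩 N).exists_strongDual_eq_one hy
    -- Since `g y = 1`, `T` factors as `(g ⊗ x)(f ⊗ y)`. A factor of trace zero is corrected by
    -- adding the idempotent `g ⊗ y`.
    have hgy0 : g y ≠ 0 := hgy ▸ one_ne_zero
    let Q : nestAlgebra 𝒩 := ⟨g.smulRight y, h𝒩.smulRight_mem hN hyN hg⟩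
    have hQ : Q ∈ idempotentSubalgebra 𝕜 (nestAlgebra 𝒩) :=
      mem_idempotentSubalgebra_of_eq_smulRight rfl hgy0
    let U : nestAlgebra 𝒩 := ⟨g.smulRight x, h𝒩.smulRight_mem hN hx hg⟩
    have hU : U ∈ idempotentSubalgebra 𝕜 (nestAlgebra 𝒩) := by
      by_cases h : g x = 0
      · have hadd : U + Q ∈ idempotentSubalgebra 𝕜 (nestAlgebra 𝒩) := by
          refine mem_idempotentSubalgebra_of_eq_smulRight (f := g) (x := x + y) ?_ (by simp [h, hgy])
          ext z
          simp [U, Q]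
        simpa using sub_mem hadd hQ
      · exact mem_idempotentSubalgebra_of_eq_smulRight rfl h
    let V : nestAlgebra 𝒩 := ⟨f.smulRight y, h𝒩.smulRight_mem hN hyN hf⟩
    have hV : V ∈ idempotentSubalgebra 𝕜 (nestAlgebra 𝒩) := by
      by_cases h : f y = 0
      · have hadd : V + Q ∈ idempotentSubalgebra 𝕜 (nestAlgebra 𝒩) := by
          refine mem_idempotentSubalgebra_of_eq_smulRight (f := f + g) (x := y) ?_ (by simp [h, hgy])
          ext z
          simp [V, Q, add_smul]
        simpa using sub_mem hadd hQ
      · exact mem_idempotentSubalgebra_of_eq_smulRight rfl h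
    have hUV : T = U * V := by
      apply Subtype.ext
      ext z
      simp [U, V, hT, hgy]
    rw [hUV]
    exact mul_mem hU hV

end NestAlgebras

theorem corollary3p6 {𝕜 X : Type*} [RCLike 𝕜] [NormedAddCommGroup X] [NormedSpace 𝕜 X]
    [CompleteSpace X] (hdim : 2 ≤ Module.rank 𝕜 X)
    (𝒩 : Set (ClosedSubmodule 𝕜 X)) (h𝒩 : IsNest 𝒩)
    (hcompl : ∀ N ∈ 𝒩, nestPred 𝒩 N = N → N.toSubmodule.ClosedComplemented)
    (δ : nestAlgebra 𝒩 →ₗ[𝕜] nestAlgebra 𝒩) :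
    List.TFAE [
      IsGeneralizedDerivation δ,
      IsLocalGeneralizedDerivation δ,
      ∀ A B C : nestAlgebra 𝒩, A * B = 0 → B * C = 0 → A * δ B * C = 0] := by
  tfae_have 1 → 2 := fun h _ => ⟨δ, h, rfl⟩
  tfae_have 2 → 3 := fun h _ _ _ hAB hBC => h.mul_apply_mul_eq_zero hAB hBC
  tfae_have 3 → 1 := fun h => isGeneralizedDerivation_of_faithful_ideal h (nestRankOne 𝒩)
    (h𝒩.nestRankOne_subset_idempotentSubalgebra hcompl)
    (fun _ hT A => h𝒩.mul_mem_nestRankOne_right hT A)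
    (fun _ hT A => mul_mem_nestRankOne_left hT A)
    h𝒩.eq_zero_of_forall_nestRankOne_mul h𝒩.eq_zero_of_forall_mul_nestRankOne
  tfae_finish
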